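/- **No-stealth theorem.** Let $A$ and $B$ be finite-dimensional quantum systems with $|A|\ge 2$ and $|B|\ge 1$. For a system $X$ of dimension $|X|$ let $\mathfrak{B}(X)$ be the algebra of operators on $X$, $\mathfrak{L}(X)$ the space of linear maps $\mathfrak{B}(X)\to\mathfrak{B}(X)$, $\mathfrak{C}(X)\subset\mathfrak{L}(X)$ the set of quantum channels (completely positive trace-preserving maps), $\tilde{\mathfrak{C}}(X)\subset\mathfrak{L}(X)$ the set of subchannels (completely positive trace-nonincreasing maps), and $\pi_X=|X|^{-1}\mathbb{1}_X$. The supertrace is $\mathfrak{Tr}[\mathcal{M}]=\mathrm{Tr}[\mathcal{M}(\pi_X)]$ for $\mathcal{M}\in\mathfrak{L}(X)$, and the partial supertraces of $\mathcal{M}\in\mathfrak{L}(AB)$ are the maps $\mathfrak{Tr}_B[\mathcal{M}](\rho)=\mathrm{Tr}_B[\mathcal{M}(\rho\otimes\pi_B)]$ in $\mathfrak{L}(A)$ and $\mathfrak{Tr}_A[\mathcal{M}](\sigma)=\mathrm{Tr}_A[\mathcal{M}(\pi_A\otimes\sigma)]$ in $\mathfrak{L}(B)$. A superunitary operation on $AB$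 is a map $\Omega:\mathfrak{L}(AB)\to\mathfrak{L}(AB)$ of the form $\Omega(\mathcal{M})=\mathrm{Ad}_{U_1}\circ\mathcal{M}\circ\mathrm{Ad}_{U_0}$ with unitary operators $U_0,U_1$ on $AB$, where $\mathrm{Ad}_U(K)=UKU^\dagger$. Then a quantum process on $A$ cannot be hidden from both $A$ and $B$ by a superunitary operation on $AB$ without a randomness source: for every superunitary operation $\Omega$ on $AB$ there are no channels $\mathcal{E}\in\mathfrak{C}(A)$ and $\mathcal{F}\in\mathfrak{C}(B)$ such that $$\mathfrak{Tr}_B[\Omega(\mathcal{N}\otimes\mathrm{id}_B)]=\mathfrak{Tr}[\mathcal{N}]\,\mathcal{E}\quad\text{and}\quad \mathfrak{Tr}_A[\Omega(\mathcal{N}\otimes\mathrm{id}_B)]=\mathfrak{Tr}[\mathcal{N}]\,\mathcal{F}\qquad\text{for all }\mathcal{N}\in\tilde{\mathfrak{C}}(A).$$ -/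

import Mathlib

open scoped Kronecker ComplexOrder

namespace QuantumProcess

/-- Operators on the system with Hilbert space `ℂ^X`. -/
abbrev Op (X : Type*) := Matrix X X ℂ

/-- `𝔏(X)`: linear maps from the operators on `X` to themselves. -/
abbrev Proc (X : Type*) := Op X →ₗ[ℂ] Op X

/-- The map `Φ ⊗ id_K`: apply `Φ` to each of the blocks `M_{k l} ∈ 𝔅(X)` of `M ∈ 𝔅(X ⊗ K)`. -/
def tensorId {X : Type*} (Φ : Proc X) (K : Type*) : Proc (X × K) where
  toFun M := Matrix.of fun p q =>
    Φ (Matrix.of fun x x' => M (x, p.2) (x', q.2)) p.1 q.1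
  map_add' M N := by
    ext p q
    exact congrFun (congrFun (Φ.map_add (Matrix.of fun x x' => M (x, p.2) (x', q.2))
      (Matrix.of fun x x' => N (x, p.2) (x', q.2))) p.1) q.1
  map_smul' c M := by
    ext p q
    exact congrFun (congrFun (Φ.map_smul c
      (Matrix.of fun x x' => M (x, p.2) (x', q.2))) p.1) q.1

/-- `Φ ⊗ id_K` does on product operators what its name says. -/
theorem tensorId_kronecker {X K : Type*} (Φ : Proc X) (S : Op X) (T : Op K) :
    tensorId Φ K (S ⊗ₖ T) = Φ S ⊗ₖ T := by
  ext p q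
  have h : (Matrix.of fun x x' => (S ⊗ₖ T) (x, p.2) (x', q.2)) = T p.2 q.2 • S := by
    ext x x'; simp [mul_comm]
  simp only [tensorId, LinearMap.coe_mk, AddHom.coe_mk, Matrix.of_apply, h]
  simp [mul_comm]

/-- Complete positivity: every `Φ ⊗ id_k` maps positive operators to positive operators. -/
def IsCompletelyPositive {X : Type*} [Fintype X] (Φ : Proc X) : Prop :=
  ∀ (k : ℕ) (M : Op (X × Fin k)), M.PosSemidef → (tensorId Φ (Fin k) M).PosSemidef

/-- Quantum channels: completely positive, trace-preserving. -/
def IsChannel {X : Type*} [Fintype X] (Φ : Proc X) : Prop :=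
  IsCompletelyPositive Φ ∧ ∀ M : Op X, (Φ M).trace = M.trace

/-- Quantum subchannels: completely positive, trace-nonincreasing (on positive operators, whose
traces are real). -/
def IsSubchannel {X : Type*} [Fintype X] (Φ : Proc X) : Prop :=
  IsCompletelyPositive Φ ∧ ∀ M : Op X, M.PosSemidef → (Φ M).trace.re ≤ M.trace.re

/-- `Ad_U : M ↦ U M U†`. -/
def Ad {X : Type*} [Fintype X] (U : Op X) : Proc X where
  toFun M := U * M * U.conjTranspose
  map_add' M N := by simp [mul_add, add_mul]
  map_smul' c M := by simp

/-- A linear supermap on `X` is superunitary if it has the form `M ↦ Ad_{U₁} ∘ M ∘ Ad_{U₀}` with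
unitary `U₀, U₁` (such a map is automatically a superchannel). -/
def IsSuperunitary {X : Type*} [Fintype X] [DecidableEq X] (Ω : Proc X →ₗ[ℂ] Proc X) : Prop :=
  ∃ U₀ ∈ Matrix.unitaryGroup X ℂ, ∃ U₁ ∈ Matrix.unitaryGroup X ℂ,
    ∀ M : Proc X, Ω M = Ad U₁ ∘ₗ M ∘ₗ Ad U₀

/-- The maximally mixed state `π_X = |X|⁻¹ 1`. -/
noncomputable def maxMixed (X : Type*) [Fintype X] [DecidableEq X] : Op X :=
  (Fintype.card X : ℂ)⁻¹ • (1 : Op X)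

/-- The supertrace `𝔗𝔯[M] = Tr[M(π_X)]`. -/
noncomputable def supertrace {X : Type*} [Fintype X] [DecidableEq X] (M : Proc X) : ℂ :=
  (M (maxMixed X)).trace

/-- The partial trace over the second factor. -/
def partialTraceRight (X Y : Type*) [Fintype Y] : Op (X × Y) →ₗ[ℂ] Op X where
  toFun M := Matrix.of fun x x' => ∑ y, M (x, y) (x', y)
  map_add' M N := by ext; simp [Finset.sum_add_distrib]
  map_smul' c M := by ext; simp [Finset.mul_sum]

/-- The partial trace over the first factor. -/
def partialTraceLeft (X Y : Type*) [Fintype X] : Op (X × Y) →ₗ[ℂ] Op Y where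
  toFun M := Matrix.of fun y y' => ∑ x, M (x, y) (x, y')
  map_add' M N := by ext; simp [Finset.sum_add_distrib]
  map_smul' c M := by ext; simp [Finset.mul_sum]

/-- The partial supertrace `𝔗𝔯_Y`: maximally mixed input on `Y`, output on `Y` traced out, i.e.
`𝔗𝔯_Y[M](ρ) = Tr_Y[M(ρ ⊗ π_Y)]`. -/
noncomputable def supertraceRight {X Y : Type*} [Fintype Y] [DecidableEq Y]
    (M : Proc (X × Y)) : Proc X where
  toFun ρ := partialTraceRight X Y (M (ρ ⊗ₖ maxMixed Y))
  map_add' ρ σ := by simp [Matrix.add_kronecker]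
  map_smul' c ρ := by simp [Matrix.smul_kronecker]

/-- The partial supertrace `𝔗𝔯_X`, i.e. `𝔗𝔯_X[M](σ) = Tr_X[M(π_X ⊗ σ)]`. -/
noncomputable def supertraceLeft {X Y : Type*} [Fintype X] [DecidableEq X]
    (M : Proc (X × Y)) : Proc Y where
  toFun σ := partialTraceLeft X Y (M (maxMixed X ⊗ₖ σ))
  map_add' ρ σ := by simp [Matrix.kronecker_add]
  map_smul' c σ := by simp [Matrix.kronecker_smul]

end QuantumProcess

open QuantumProcess

namespace QuantumProcess

open Matrix

/-! Test hiding on the single-Kraus subchannels `Ad (diagonal v)`. The output is `Ad M` with M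
linear in v, and so is its realignment R(v). Up to dimension factors and a transpose, the Choi
matrices of its partial supertraces on A and B are R Rᴴ and Rᴴ R, so hiding makes both depend on v
only through ‖v‖². On B, polarization at basis vectors eᵢ ≠ eⱼ gives R(eⱼ)ᴴ R(eᵢ) = 0; on A, R(eᵢ)
R(eᵢ)ᴴ = R(eⱼ) R(eⱼ)ᴴ. Together these force R(eᵢ) = 0, impossible since realignment is injective and
the unitaries cancel. -/

theorem tensorId_Ad {X K : Type*} [Fintype X] [Fintype K] [DecidableEq K] (S : Op X) :
    tensorId (Ad S) K = Ad (S ⊗ₖ (1 : Op K)) := by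
  ext1 M
  ext p q
  simp [tensorId, Ad, Matrix.mul_apply, Fintype.sum_prod_type, Matrix.one_apply, apply_ite]

theorem Ad_comp {X : Type*} [Fintype X] (S T : Op X) : Ad S ∘ₗ Ad T = Ad (S * T) := by
  ext1 M
  simp [Ad, Matrix.mul_assoc]

theorem isCompletelyPositive_Ad {X : Type*} [Fintype X] (S : Op X) :
    IsCompletelyPositive (Ad S) := by
  intro k M hM
  rw [tensorId_Ad]
  exact hM.mul_mul_conjTranspose_same _

theorem isSubchannel_Ad_diagonal {X : Type*} [Fintype X] [DecidableEq X] {v : X → ℂ}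
    (hv : ∀ x, Complex.normSq (v x) ≤ 1) : IsSubchannel (Ad (diagonal v)) := by
  refine ⟨isCompletelyPositive_Ad _, fun M hM => ?_⟩
  simp only [Ad, LinearMap.coe_mk, AddHom.coe_mk, Matrix.trace, Matrix.diag_apply,
    diagonal_conjTranspose, mul_diagonal, diagonal_mul, Complex.re_sum]
  refine Finset.sum_le_sum fun x _ => ?_
  have h0 : 0 ≤ (M x x).re := (Complex.le_def.1 (hM.diag_nonneg (i := x))).1
  have h1 : v x * M x x * star v x = (Complex.normSq (v x) : ℂ) * M x x := by
    rw [Complex.normSq_eq_conj_mul_self, Pi.star_apply, starRingEnd_apply]; ring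
  rw [h1, Complex.re_ofReal_mul]
  exact mul_le_of_le_one_left h0 (hv x)

theorem supertrace_Ad_diagonal {X : Type*} [Fintype X] [DecidableEq X] (v : X → ℂ) :
    supertrace (Ad (diagonal v)) =
      (Fintype.card X : ℂ)⁻¹ * ∑ x, (Complex.normSq (v x) : ℂ) := by
  simp [supertrace, Ad, maxMixed, Matrix.trace, Finset.mul_sum, Complex.mul_conj]

/-- The realignment of an operator on `XY`: the coefficient matrix of its expansion in products of
matrix units on `X` and on `Y`. -/
def realign {X Y : Type*} : Op (X × Y) →ₗ[ℂ] Matrix (X × X) (Y × Y) ℂ where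
  toFun M := Matrix.of fun p q => M (p.1, q.1) (p.2, q.2)
  map_add' _ _ := rfl
  map_smul' _ _ := rfl

theorem realign_apply {X Y : Type*} (M : Op (X × Y)) (p : X × X) (q : Y × Y) :
    realign M p q = M (p.1, q.1) (p.2, q.2) := rfl

theorem realign_injective {X Y : Type*} :
    Function.Injective (realign : Op (X × Y) →ₗ[ℂ] Matrix (X × X) (Y × Y) ℂ) := by
  intro M N h
  ext p q
  exact congrFun (congrFun h (p.1, q.1)) (p.2, q.2)

/-- The maximally mixed input and the traced output contract exactly the (output, input) index pair
on `Y`, which is the column index of the realignment. -/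
theorem supertraceRight_Ad_single {X Y : Type*} [Fintype X] [DecidableEq X] [Fintype Y]
    [DecidableEq Y] (M : Op (X × Y)) (x x' a a' : X) :
    supertraceRight (Ad M) (single a a' 1) x x' =
      (Fintype.card Y : ℂ)⁻¹ * (realign M * (realign M)ᴴ) (x, a) (x', a') := by
  simp [supertraceRight, partialTraceRight, Ad, realign_apply, maxMixed, Matrix.mul_apply,
    Fintype.sum_prod_type, Matrix.single_apply, Matrix.one_apply, Finset.mul_sum, ite_and,
    Finset.sum_mul]
  refine Finset.sum_congr rfl fun _ _ => Finset.sum_congr rfl fun _ _ => ?_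
  ring

/-- Here the row pair is contracted, and the Gram matrix appears transposed. -/
theorem supertraceLeft_Ad_single {X Y : Type*} [Fintype X] [DecidableEq X] [Fintype Y]
    [DecidableEq Y] (M : Op (X × Y)) (y y' b b' : Y) :
    supertraceLeft (Ad M) (single b b' 1) y y' =
      (Fintype.card X : ℂ)⁻¹ * ((realign M)ᴴ * realign M) (y', b') (y, b) := by
  simp [supertraceLeft, partialTraceLeft, Ad, realign_apply, maxMixed, Matrix.mul_apply,
    Fintype.sum_prod_type, Matrix.single_apply, Matrix.one_apply, Finset.mul_sum, ite_and,
    Finset.sum_mul]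
  refine Finset.sum_congr rfl fun _ _ => Finset.sum_congr rfl fun _ _ => ?_
  ring

theorem realign_mul_conjTranspose_eq {X Y : Type*} [Fintype X] [DecidableEq X] [Fintype Y]
    [DecidableEq Y] [Nonempty Y] {M : Op (X × Y)} {c : ℂ} {E : Proc X}
    (h : supertraceRight (Ad M) = c • E) :
    realign M * (realign M)ᴴ =
      c • Matrix.of fun p q => (Fintype.card Y : ℂ) * E (single p.2 q.2 1) p.1 q.1 := by
  ext p q
  have h1 := supertraceRight_Ad_single M p.1 q.1 p.2 q.2
  have hY : (Fintype.card Y : ℂ) ≠ 0 := Nat.cast_ne_zero.2 Fintype.card_ne_zero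
  rw [h, eq_inv_mul_iff_mul_eq₀ hY] at h1
  rw [← h1]
  simp [mul_left_comm]

theorem conjTranspose_realign_mul_eq {X Y : Type*} [Fintype X] [DecidableEq X] [Fintype Y]
    [DecidableEq Y] [Nonempty X] {M : Op (X × Y)} {c : ℂ} {F : Proc Y}
    (h : supertraceLeft (Ad M) = c • F) :
    (realign M)ᴴ * realign M =
      c • Matrix.of fun p q => (Fintype.card X : ℂ) * F (single q.2 p.2 1) q.1 p.1 := by
  ext p q
  have h1 := supertraceLeft_Ad_single M q.1 p.1 q.2 p.2
  have hX : (Fintype.card X : ℂ) ≠ 0 := Nat.cast_ne_zero.2 Fintype.card_ne_zero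
  rw [h, eq_inv_mul_iff_mul_eq₀ hX] at h1
  rw [← h1]
  simp [mul_left_comm]

/-- Polarization of `M ↦ Mᴴ * M`. -/
theorem conjTranspose_mul_eq_zero_of_add {m n : Type*} [Fintype m] {P Q : Matrix m n ℂ}
    (h₁ : (P + Q)ᴴ * (P + Q) = Pᴴ * P + Qᴴ * Q)
    (h₂ : (P + Complex.I • Q)ᴴ * (P + Complex.I • Q) = Pᴴ * P + Qᴴ * Q) :
    Qᴴ * P = 0 := by
  simp only [conjTranspose_add, conjTranspose_smul, Matrix.add_mul, Matrix.mul_add,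
    Matrix.smul_mul, Matrix.mul_smul] at h₁ h₂
  ext i j
  have e₁ := congrFun (congrFun h₁ i) j
  have e₂ := congrFun (congrFun h₂ i) j
  simp only [Matrix.add_apply, Matrix.smul_apply, smul_eq_mul, Complex.star_def,
    Complex.conj_I] at e₁ e₂
  rw [Matrix.zero_apply]
  -- The cross terms are PᴴQ + QᴴP in `e₁` and i(PᴴQ − QᴴP) in `e₂`; this combination isolates QᴴP.
  linear_combination (1 / 2 : ℂ) * e₁ + (Complex.I / 2) * e₂
    + ((Complex.I / 2) * (Qᴴ * Q) i j + (1 / 2) * (Qᴴ * P) i j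
      - (1 / 2) * (Pᴴ * Q) i j) * Complex.I_sq

/-- Two operators with the same positive part on one side and orthogonal on the other vanish. -/
theorem eq_zero_of_mul_conjTranspose_eq {m n : Type*} [Fintype m] [Fintype n]
    {P Q : Matrix m n ℂ} (h : P * Pᴴ = Q * Qᴴ) (h' : Qᴴ * P = 0) : P = 0 := by
  have h₁ : P * Pᴴ * P = 0 := by rw [h, Matrix.mul_assoc, h', Matrix.mul_zero]
  exact conjTranspose_mul_self_eq_zero.1 ((self_mul_conjTranspose_mul_eq_zero _ _).1 h₁)

end QuantumProcess

open QuantumProcess Matrix in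
theorem mainTheorem4 {A B : Type*} [Fintype A] [DecidableEq A] [Nontrivial A]
    [Fintype B] [DecidableEq B] [Nonempty B]
    (Ω : Proc (A × B) →ₗ[ℂ] Proc (A × B)) (hΩ : IsSuperunitary Ω) :
    ¬ ∃ (E : Proc A) (F : Proc B), IsChannel E ∧ IsChannel F ∧
      ∀ N : Proc A, IsSubchannel N →
        supertraceRight (Ω (tensorId N B)) = supertrace N • E ∧
        supertraceLeft (Ω (tensorId N B)) = supertrace N • F := by
  rintro ⟨E, F, -, -, hEF⟩
  obtain ⟨U₀, hU₀, U₁, hU₁, hΩ⟩ := hΩ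
  obtain ⟨i, j, hij⟩ := exists_pair_ne A
  let R : (A → ℂ) →ₗ[ℂ] Matrix (A × A) (B × B) ℂ :=
    { toFun := fun v => realign (U₁ * (diagonal v ⊗ₖ (1 : Op B) * U₀))
      map_add' := fun v w => by
        rw [← map_add, ← Matrix.mul_add, ← Matrix.add_mul, ← add_kronecker, diagonal_add]; rfl
      map_smul' := fun c v => by
        rw [diagonal_smul, smul_kronecker, Matrix.smul_mul, Matrix.mul_smul, map_smul]; rfl }
  have key : ∀ v : A → ℂ, (∀ x, Complex.normSq (v x) ≤ 1) →
      supertraceRight (Ad (U₁ * (diagonal v ⊗ₖ (1 : Op B) * U₀)))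
        = supertrace (Ad (diagonal v)) • E ∧
      supertraceLeft (Ad (U₁ * (diagonal v ⊗ₖ (1 : Op B) * U₀)))
        = supertrace (Ad (diagonal v)) • F := by
    intro v hv
    have h := hEF _ (isSubchannel_Ad_diagonal hv)
    rwa [hΩ, tensorId_Ad, Ad_comp, Ad_comp] at h
  have right := fun v hv => realign_mul_conjTranspose_eq (key v hv).1
  have left := fun v hv => conjTranspose_realign_mul_eq (key v hv).2
  -- The vector eᵢ + c eⱼ needs no normalization: a subchannel only requires each entry to have
  -- modulus at most 1. Its squared norm 2 = 1 + 1 makes the cross terms cancel in `polar`.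
  have hsum : ∀ c : ℂ, Complex.normSq c = 1 →
      (∀ x, Complex.normSq ((Pi.single i 1 + c • Pi.single j 1 : A → ℂ) x) ≤ 1) ∧
      ∑ x, (Complex.normSq ((Pi.single i 1 + c • Pi.single j 1 : A → ℂ) x) : ℂ) = 2 := by
    intro c hc
    have h : ∀ x, Complex.normSq ((Pi.single i 1 + c • Pi.single j 1 : A → ℂ) x)
        = (if x = i then 1 else 0) + (if x = j then 1 else 0) := by
      intro x
      by_cases hi : x = i
      · subst hi; simp [hij]
      · by_cases hj : x = j
        · subst hj; simp [hi, hc]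
        · simp [hi, hj]
    refine ⟨fun x => ?_, ?_⟩
    · rw [h]
      split_ifs with h₁ h₂
      · exact absurd (h₁.symm.trans h₂) hij
      all_goals norm_num
    · simp only [h, ← Complex.ofReal_sum, Finset.sum_add_distrib]
      simp [one_add_one_eq_two]
  have hone : ∀ k : A, (∀ x, Complex.normSq ((Pi.single k 1 : A → ℂ) x) ≤ 1) ∧
      ∑ x, (Complex.normSq ((Pi.single k 1 : A → ℂ) x) : ℂ) = 1 := by
    intro k
    have h : ∀ x, Complex.normSq ((Pi.single k 1 : A → ℂ) x) = if x = k then 1 else 0 := by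
      intro x
      by_cases hk : x = k
      · subst hk; simp
      · simp [hk]
    refine ⟨fun x => ?_, ?_⟩
    · rw [h]; split_ifs <;> norm_num
    · simp only [h, ← Complex.ofReal_sum]; simp
  have polar : ∀ c : ℂ, Complex.normSq c = 1 →
      (R (Pi.single i 1) + c • R (Pi.single j 1))ᴴ * (R (Pi.single i 1) + c • R (Pi.single j 1))
        = (R (Pi.single i 1))ᴴ * R (Pi.single i 1)
          + (R (Pi.single j 1))ᴴ * R (Pi.single j 1) := by
    intro c hc
    rw [← map_smul, ← map_add]
    refine (left _ (hsum c hc).1).trans (.symm (congrArg₂ (· + ·) (left _ (hone i).1)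
      (left _ (hone j).1) |>.trans ?_))
    simp only [supertrace_Ad_diagonal, (hsum c hc).2, (hone _).2, ← add_smul]
    congr 1
    ring
  have horth : (R (Pi.single j 1))ᴴ * R (Pi.single i 1) = 0 :=
    conjTranspose_mul_eq_zero_of_add (by simpa using polar 1 (by simp))
      (polar Complex.I (by simp))
  have heq : R (Pi.single i 1) * (R (Pi.single i 1))ᴴ
      = R (Pi.single j 1) * (R (Pi.single j 1))ᴴ := by
    refine (right _ (hone i).1).trans (.trans ?_ (right _ (hone j).1).symm)
    simp only [supertrace_Ad_diagonal, (hone _).2]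
  have hR : realign (U₁ * (diagonal (Pi.single i 1) ⊗ₖ (1 : Op B) * U₀)) = 0 :=
    eq_zero_of_mul_conjTranspose_eq heq horth
  have hz := realign_injective (hR.trans (map_zero _).symm)
  have hz' : diagonal (Pi.single i 1 : A → ℂ) ⊗ₖ (1 : Op B) = 0 := by
    -- Undoing both unitaries leaves the projector onto eᵢ tensored with 1, whose (i, b) diagonal
    -- entry is 1.
    have := congrArg (fun M => star U₁ * M * star U₀) hz
    simpa [← Matrix.mul_assoc, (mem_unitaryGroup_iff'.1 hU₁),
      Matrix.mul_assoc _ U₀, (mem_unitaryGroup_iff.1 hU₀)] using this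
  obtain ⟨b⟩ := ‹Nonempty B›
  simpa using congrFun (congrFun hz' (i, b)) (i, b)
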